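/- Let $k$ be a field and let $A$ be a unital DG $k$-algebra, $\mathbb Z$-graded with a differential of degree $+1$ and with no boundedness assumption. Let $\mathsf{Mod}\,A$ be the DG category of right DG $A$-modules: the morphisms $M\to N$ of degree $n$ are the $A$-linear maps that raise degrees by $n$, and $d(f)=d_N f-(-1)^n f d_M$. The homotopy category $\mathsf{Ho}(\mathcal C)$ of a DG category $\mathcal C$ has the objects of $\mathcal C$ and the morphism spaces $H^0(\mathrm{Hom}_{\mathcal C}(X,Y))$. The shift $N[1]$ has $N[1]^n=N^{n+1}$, differential $-d_N$ and the same right action. The cone of a closed degree $0$ morphism $p:L\to M$ is $\mathrm{Cone}(p)=L[1]\oplus M$ with differential $(l,m)\mapsto(-dl,\;p(l)+dm)$. A triangle $X\to Y\to Z\to X[1]$ in $\mathsf{Ho}(\mathsf{Mod}\,A)$ is distinguished if it is isomorphic to $L\xrightarrow{p}M\to\mathrm{Cone}(p)\to L[1]$ for some such $p$, with the obvious last two maps. A DG module is finitely generated free if it is isomorphic to $K\otimes_k A$ for a finite dimensional graded vector space $K$; it is finitely generated semi-free if it is obtained (up to isomorphism) from finitely generated free modules by successively taking cones of closed degree $0$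 morphisms; it is perfect if it is a direct summand in $\mathsf{Ho}(\mathsf{Mod}\,A)$ of a finitely generated semi-free module (that is, some idempotent endomorphism of the latter in $\mathsf{Ho}(\mathsf{Mod}\,A)$ splits through it). Let $\mathsf{Perf}\,A\subset\mathsf{Mod}\,A$ be the full DG subcategory of perfect modules; a triangle in $\mathsf{Ho}(\mathsf{Perf}\,A)$ is distinguished if it is distinguished in $\mathsf{Ho}(\mathsf{Mod}\,A)$. Let $K_0(\mathsf{Ho}(\mathsf{Perf}\,A))$ be the abelian group generated by symbols $[N]$, $N\in\mathsf{Perf}\,A$, with the relations $[M]=[L]+[N]$ for all distinguished triangles $L\to M\to N\to L[1]$. For a DG category $\mathcal C$, let $\mathsf{HH}_m(\mathcal C)$ be the $m$-th cohomology of the Hochschild complex $$\mathsf C_\bullet(\mathcal C)=\bigoplus_{n\ge0}\ \bigoplus_{X_0,\dots,X_n}\mathrm{Hom}(X_n,X_0)\otimes\mathrm{Hom}(X_{n-1},X_n)[1]\otimes\cdots\otimes\mathrm{Hom}(X_0,X_1)[1],$$ whose element $a_0[a_1|\dots|a_n]$ has degree $\eta_n$, where $\eta_i=|a_0|+\sum_{j=1}^i(|a_j|-1)$,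 and whose differential $b=b_0+b_1$ is given by $$b_0(a_0[a_1|\dots|a_n])=da_0[a_1|\dots|a_n]-\sum_{i=1}^n(-1)^{\eta_{i-1}}a_0[a_1|\dots|da_i|\dots|a_n],$$ $$b_1(a_0[a_1|\dots|a_n])=(-1)^{|a_0|}a_0a_1[a_2|\dots|a_n]+\sum_{i=1}^{n-1}(-1)^{\eta_i}a_0[a_1|\dots|a_ia_{i+1}|\dots|a_n]-(-1)^{\eta_{n-1}(|a_n|+1)}a_na_0[a_1|\dots|a_{n-1}]$$ for $n\ge1$, and $b_1(a_0)=0$. For $N\in\mathsf{Perf}\,A$ let the Euler class $\mathsf{Eu}(N)\in\mathsf{HH}_0(\mathsf{Perf}\,A)$ be the class of the identity morphism $1_N$. Then: 1. $\mathsf{Eu}(N[1])=-\mathsf{Eu}(N)$ for every $N\in\mathsf{Perf}\,A$. 2. $\mathsf{Eu}(M)=\mathsf{Eu}(L)+\mathsf{Eu}(N)$ for every distinguished triangle $L\to M\to N\to L[1]$ in $\mathsf{Ho}(\mathsf{Perf}\,A)$. 3. Hence $\mathsf{Eu}$ factors through the Grothendieck group: there is a unique group homomorphism $\varphi:K_0(\mathsf{Ho}(\mathsf{Perf}\,A))\to\mathsf{HH}_0(\mathsf{Perf}\,A)$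 with $\varphi([N])=\mathsf{Eu}(N)$ for all $N\in\mathsf{Perf}\,A$. -/

import Mathlib

open CategoryTheory
open scoped DirectSum TensorProduct

universe u v w

noncomputable section

namespace DG

/-! ### DG algebras and right DG modules -/

/-- A unital DG algebra over `k`, with cohomological grading by `ℤ` (no boundedness condition). -/
structure DGAlgebra (k : Type u) [Field k] where
  carrier : Type v
  [ring : Ring carrier]
  [algebra : Algebra k carrier]
  gr : ℤ → Submodule k carrier
  [graded : GradedAlgebra gr]
  d : carrier →ₗ[k] carrier
  d_mem : ∀ {n : ℤ} {a : carrier}, a ∈ gr n → d a ∈ gr (n + 1)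
  d_d : ∀ a : carrier, d (d a) = 0
  d_mul : ∀ {n : ℤ} {a : carrier} (b : carrier), a ∈ gr n →
    d (a * b) = d a * b + n.negOnePow • (a * d b)

attribute [instance] DGAlgebra.ring DGAlgebra.algebra DGAlgebra.graded

variable {k : Type u} [Field k]

/-- A right DG module over `A`; the right action of `a` on `m` is `MulOpposite.op a • m`. -/
structure DGModule (A : DGAlgebra.{u, v} k) where
  carrier : Type v
  [addCommGroup : AddCommGroup carrier]
  [module : Module k carrier]
  [moduleOp : Module A.carrierᵐᵒᵖ carrier]
  [tower : IsScalarTower k A.carrierᵐᵒᵖ carrier]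
  gr : ℤ → Submodule k carrier
  isInternal : DirectSum.IsInternal gr
  smul_mem : ∀ {i j : ℤ} {m : carrier} {a : A.carrier}, m ∈ gr i → a ∈ A.gr j →
    MulOpposite.op a • m ∈ gr (i + j)
  d : carrier →ₗ[k] carrier
  d_mem : ∀ {i : ℤ} {m : carrier}, m ∈ gr i → d m ∈ gr (i + 1)
  d_d : ∀ m : carrier, d (d m) = 0
  d_smul : ∀ {i : ℤ} {m : carrier} (a : A.carrier), m ∈ gr i →
    d (MulOpposite.op a • m) = MulOpposite.op a • d m + i.negOnePow • (MulOpposite.op (A.d a) • m)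

attribute [instance] DGModule.addCommGroup DGModule.module DGModule.moduleOp DGModule.tower

/-! ### DG categories -/

/-- A DG category over `k`: complexes `Hom X Y`, given degreewise, with bilinear composition
`comp f g = f ∘ g` of degree zero satisfying the graded Leibniz rule. -/
structure DGCategory (k : Type u) [Field k] where
  Obj : Type v
  Hom : Obj → Obj → ℤ → Type w
  [homAddCommGroup : ∀ X Y n, AddCommGroup (Hom X Y n)]
  [homModule : ∀ X Y n, Module k (Hom X Y n)]
  d : ∀ {X Y : Obj} {n m : ℤ}, n + 1 = m → (Hom X Y n →ₗ[k] Hom X Y m)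
  comp : ∀ {X Y Z : Obj} {m n p : ℤ}, m + n = p →
    (Hom Y Z m →ₗ[k] Hom X Y n →ₗ[k] Hom X Z p)
  one : ∀ X : Obj, Hom X X 0
  d_d : ∀ {X Y : Obj} {n m l : ℤ} (h : n + 1 = m) (h' : m + 1 = l) (f : Hom X Y n),
    d h' (d h f) = 0
  one_comp : ∀ {X Y : Obj} {n : ℤ} (f : Hom X Y n), comp (zero_add n) (one Y) f = f
  comp_one : ∀ {X Y : Obj} {n : ℤ} (f : Hom X Y n), comp (add_zero n) f (one X) = f
  comp_assoc : ∀ {W X Y Z : Obj} {l m n lm mn t : ℤ} (h₁ : l + m = lm) (h₂ : m + n = mn)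
    (h₃ : lm + n = t) (h₄ : l + mn = t) (f : Hom Y Z l) (g : Hom X Y m) (e : Hom W X n),
    comp h₃ (comp h₁ f g) e = comp h₄ f (comp h₂ g e)
  leibniz : ∀ {X Y Z : Obj} {m n p m' n' p' : ℤ} (h : m + n = p) (hm : m + 1 = m')
    (hn : n + 1 = n') (hp : p + 1 = p') (h₁ : m' + n = p') (h₂ : m + n' = p')
    (f : Hom Y Z m) (g : Hom X Y n),
    d hp (comp h f g) = comp h₁ (d hm f) g + m.negOnePow • comp h₂ f (d hn g)

attribute [instance] DGCategory.homAddCommGroup DGCategory.homModule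

namespace DGCategory

theorem d_one (C : DGCategory.{u, v, w} k) (X : C.Obj) {m : ℤ} (h : 0 + 1 = m) :
    C.d h (C.one X) = 0 := by
  have hm : (1 : ℤ) = m := by omega
  subst hm
  have e := C.leibniz (zero_add 0) h h h (add_zero 1) (zero_add 1) (C.one X) (C.one X)
  rw [C.one_comp, C.one_comp, C.comp_one] at e
  simpa using e

/-- The full DG subcategory on the objects satisfying `P`. -/
abbrev fullSub (C : DGCategory.{u, v, w} k) (P : C.Obj → Prop) : DGCategory.{u, v, w} k where
  Obj := {X : C.Obj // P X}
  Hom X Y n := C.Hom X.1 Y.1 n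
  d h := C.d h
  comp h := C.comp h
  one X := C.one X.1
  d_d := C.d_d
  one_comp := C.one_comp
  comp_one := C.comp_one
  comp_assoc := C.comp_assoc
  leibniz := C.leibniz

/-- The objects of `C`, as objects of the category of closed morphisms of degree `0`. -/
structure Z0 (C : DGCategory.{u, v, w} k) where
  as : C.Obj

/-- Closed morphisms of degree `0`. -/
@[ext]
structure Z0.Hom {C : DGCategory.{u, v, w} k} (X Y : Z0 C) where
  val : C.Hom X.as Y.as 0
  closed : C.d (zero_add 1) val = 0

instance (C : DGCategory.{u, v, w} k) : Category (Z0 C) where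
  Hom X Y := Z0.Hom X Y
  id X := ⟨C.one X.as, C.d_one X.as _⟩
  comp f g := ⟨C.comp (add_zero 0) g.val f.val, by
    rw [C.leibniz (add_zero 0) (zero_add 1) (zero_add 1) (zero_add 1) (add_zero 1) (zero_add 1),
      f.closed, g.closed]
    simp⟩
  id_comp f := Z0.Hom.ext (C.comp_one f.val)
  comp_id f := Z0.Hom.ext (C.one_comp f.val)
  assoc f g h := Z0.Hom.ext (C.comp_assoc _ _ _ _ h.val g.val f.val).symm

/-- Closed degree `0` morphisms `f`, `g` are homotopic if `f - g = d h` with `h` of degree `-1`. -/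
def homotopyRel (C : DGCategory.{u, v, w} k) : HomRel (Z0 C) :=
  fun X Y f g => ∃ h : C.Hom X.as Y.as (-1), f.val - g.val = C.d (neg_add_cancel 1) h

instance (C : DGCategory.{u, v, w} k) : Congruence C.homotopyRel where
  comp_left {X Y Z} f g g' := by
    rintro ⟨h, e⟩
    refine ⟨C.comp (add_zero (-1)) h f.val, ?_⟩
    rw [C.leibniz (add_zero (-1)) (neg_add_cancel 1) (zero_add 1) (neg_add_cancel 1) (add_zero 0)
      (neg_add_cancel 1), f.closed, ← e, map_sub, LinearMap.sub_apply, map_zero, smul_zero,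
      add_zero]
    rfl
  comp_right {X Y Z} f f' g := by
    rintro ⟨h, e⟩
    refine ⟨C.comp (zero_add (-1)) g.val h, ?_⟩
    rw [C.leibniz (zero_add (-1)) (zero_add 1) (neg_add_cancel 1) (neg_add_cancel 1)
      (add_neg_cancel 1) (add_zero 0), g.closed, ← e, map_sub, map_zero, LinearMap.zero_apply,
      zero_add, Int.negOnePow_zero, one_smul]
    rfl
  equivalence {X Y} :=
    { refl f := ⟨0, by simp⟩
      symm := by
        rintro f g ⟨h, e⟩
        exact ⟨-h, by rw [map_neg, ← e, neg_sub]⟩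
      trans := by
        rintro f g l ⟨h, e⟩ ⟨h', e'⟩
        exact ⟨h + h', by rw [map_add, ← e, ← e', sub_add_sub_cancel]⟩ }

/-- The homotopy category `Ho C`, with `Hom(X, Y) = H⁰(Hom_C(X, Y))`. -/
abbrev Ho (C : DGCategory.{u, v, w} k) : Type v := CategoryTheory.Quotient C.homotopyRel

/-- An object of `C`, as an object of `Ho C`. -/
abbrev toHo (C : DGCategory.{u, v, w} k) (X : C.Obj) : Ho C := ⟨⟨X⟩⟩

/-- The functor to `Ho C` that sends a closed morphism of degree `0` to its homotopy class. -/
abbrev homClass (C : DGCategory.{u, v, w} k) : Z0 C ⥤ Ho C :=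
  CategoryTheory.Quotient.functor C.homotopyRel

/-! ### The Hochschild complex of a DG category -/

/-- Transport of morphisms along equalities of source, target and degree. -/
def castHom (C : DGCategory.{u, v, w} k) {X X' Y Y' : C.Obj} {n n' : ℤ}
    (hX : X = X') (hY : Y = Y') (hn : n = n') : C.Hom X Y n →ₗ[k] C.Hom X' Y' n' := by
  subst hX hY hn
  exact LinearMap.id

/-- A closed path of `n + 1` morphism slots of prescribed degrees. The slot `i` holds morphisms
`obj (i + 1) ⟶ obj i` of degree `deg i`, where `i + 1` is taken modulo `n + 1`. In terms of a
sequence `X₀, …, Xₙ` of objects, `obj 0 = X₀` and `obj i = X_{n + 1 - i}` for `1 ≤ i`, so that the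
slots are `Hom(Xₙ, X₀), Hom(X_{n - 1}, Xₙ), …, Hom(X₀, X₁)`. -/
structure Cycle (C : DGCategory.{u, v, w} k) where
  n : ℕ
  obj : Fin (n + 1) → C.Obj
  deg : Fin (n + 1) → ℤ

variable {C : DGCategory.{u, v, w} k}

/-- The morphisms that may stand in slot `i`. -/
abbrev Slot {n : ℕ} (X : Fin (n + 1) → C.Obj) (p : Fin (n + 1) → ℤ) (i : Fin (n + 1)) : Type w :=
  C.Hom (X (i + 1)) (X i) (p i)

/-- Tensors `a₀[a₁|…|aₙ] = a₀ ⊗ sa₁ ⊗ … ⊗ saₙ` with `aᵢ` in slot `i`. -/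
abbrev Words {n : ℕ} (X : Fin (n + 1) → C.Obj) (p : Fin (n + 1) → ℤ) : Type (max u w) :=
  PiTensorProduct k (fun i => Slot X p i)

/-- The space of Hochschild chains: the direct sum, over all `n`, all sequences of `n + 1` objects
and all degrees, of the spaces of words. -/
def Chains (C : DGCategory.{u, v, w} k) : Type (max u v w) :=
  DirectSum C.Cycle (fun c => Words c.obj c.deg)

instance : AddCommGroup (Chains C) :=
  inferInstanceAs (AddCommGroup (DirectSum C.Cycle (fun c => Words c.obj c.deg)))

instance : Module k (Chains C) :=
  inferInstanceAs (Module k (DirectSum C.Cycle (fun c => Words c.obj c.deg)))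

/-- The component of a chain in one of the summands. -/
def component (c : C.Cycle) : Chains C →ₗ[k] Words c.obj c.deg :=
  DirectSum.component k C.Cycle (fun c => Words c.obj c.deg) c

open Classical in
/-- The inclusion of a summand. -/
def incl {n : ℕ} (X : Fin (n + 1) → C.Obj) (p : Fin (n + 1) → ℤ) : Words X p →ₗ[k] Chains C :=
  DirectSum.lof k C.Cycle (fun c => Words c.obj c.deg) ⟨n, X, p⟩

/-- A multilinear map into a tensor product, given by multiplying together the entries `aᵢ` with the
same `π i`: the factor `L j a` depends only on the entries with `π i = j`, and is linear in each of
them. -/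
def tensorOfFactors {ι κ : Type} [inst0 : DecidableEq ι] {V : ι → Type w} {W : κ → Type w}
    [∀ i, AddCommGroup (V i)] [∀ i, Module k (V i)] [∀ j, AddCommGroup (W j)] [∀ j, Module k (W j)]
    (π : ι → κ) (L : ∀ j, (∀ i, V i) → W j)
    (indep : ∀ a i x j, j ≠ π i → L j (Function.update a i x) = L j a)
    (add : ∀ a i x y j, j = π i → L j (Function.update a i (x + y)) =
      L j (Function.update a i x) + L j (Function.update a i y))
    (smul : ∀ a i (c : k) x j, j = π i → L j (Function.update a i (c • x)) =
      c • L j (Function.update a i x)) :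
    (PiTensorProduct k V) →ₗ[k] PiTensorProduct k W := by
  classical
  have key : ∀ a i x, (fun j => L j (Function.update a i x)) =
      Function.update (fun j => L j a) (π i) (L (π i) (Function.update a i x)) := by
    intro a i x
    funext j
    by_cases h : j = π i
    · subst h
      simp
    · rw [Function.update_of_ne h, indep a i x j h]
  exact PiTensorProduct.lift
    { toFun := fun a => PiTensorProduct.tprod k (fun j => L j a)
      map_update_add' := fun {inst} a i x y => by
        obtain rfl := Subsingleton.elim inst0 inst
        rw [key, key, key, add _ _ _ _ _ rfl, MultilinearMap.map_update_add]
      map_update_smul' := fun {inst} a i c x => by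
        obtain rfl := Subsingleton.elim inst0 inst
        rw [key, key a i x, smul _ _ _ _ _ rfl, MultilinearMap.map_update_smul] }

/-- Apply `d` to the entry in slot `i` (without sign). -/
def dAt {n : ℕ} (X : Fin (n + 1) → C.Obj) (p : Fin (n + 1) → ℤ) (i : Fin (n + 1)) :
    Words X p →ₗ[k] Words X (Function.update p i (p i + 1)) :=
  PiTensorProduct.map (fun j =>
    if h : j = i then C.d (by subst h; simp)
    else C.castHom rfl rfl (by rw [Function.update_of_ne h]))

/-- The objects left after composing the entries in the slots `i` and `i + 1`. -/
abbrev mergeObj {n : ℕ} (X : Fin (n + 2) → C.Obj) (i : Fin (n + 1)) : Fin (n + 1) → C.Obj :=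
  fun j => X (i.succ.succAbove j)

/-- The degrees after composing the entries in the slots `i` and `i + 1`. -/
def mergeDeg {n : ℕ} (p : Fin (n + 2) → ℤ) (i : Fin (n + 1)) : Fin (n + 1) → ℤ :=
  fun j => if j < i then p j.castSucc else if j = i then p i.castSucc + p i.succ else p j.succ

theorem merge_index_lt {n : ℕ} {i j : Fin (n + 1)} (hij : j < i) :
    i.succ.succAbove j = j.castSucc ∧ i.succ.succAbove (j + 1) = j.castSucc + 1 := by
  have h := Fin.lt_def.1 hij
  have hj : j.val + 1 < n + 1 := by omega
  have e : (j + 1).val = j.val + 1 := by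
    rw [Fin.val_add_one_of_lt' hj]
  have e' : (j.castSucc + 1).val = j.val + 1 := by
    rw [Fin.val_add_one_of_lt' (by simp; omega)]; rfl
  constructor
  · rw [Fin.succAbove_of_castSucc_lt]
    rw [Fin.lt_def, Fin.val_castSucc, Fin.val_succ]; omega
  · rw [Fin.succAbove_of_castSucc_lt]
    · ext; rw [Fin.val_castSucc, e, e']
    · rw [Fin.lt_def, Fin.val_castSucc, Fin.val_succ, e]; omega

theorem merge_index_ge {n : ℕ} {i j : Fin (n + 1)} (hij : i ≤ j) :
    i.succ.succAbove (j + 1) = j.succ + 1 := by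
  have h := Fin.le_def.1 hij
  by_cases hj : j.val + 1 < n + 1
  · have e : (j + 1).val = j.val + 1 := by
      rw [Fin.val_add_one_of_lt' hj]
    have e' : (j.succ + 1).val = j.val + 2 := by
      rw [Fin.val_add_one_of_lt' (by simp; omega)]; rfl
    rw [Fin.succAbove_of_le_castSucc]
    · ext; rw [Fin.val_succ, e, e']
    · rw [Fin.le_def, Fin.val_castSucc, Fin.val_succ, e]; omega
  · have hj' : j = Fin.last n := by ext; simp; omega
    subst hj'
    have e : Fin.last n + 1 = 0 := Fin.last_add_one n
    have e' : (Fin.last n).succ + 1 = 0 := Fin.last_add_one (n + 1)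
    rw [e, e', Fin.succAbove_of_castSucc_lt]
    · rfl
    · rw [Fin.castSucc_zero]; exact Fin.succ_pos i

theorem merge_index_gt {n : ℕ} {i j : Fin (n + 1)} (h : i < j) :
    i.succ.succAbove j = j.succ := by
  rw [Fin.succAbove_of_le_castSucc]
  exact Fin.succ_le_castSucc_iff.2 h

theorem castSucc_add_one {n : ℕ} (i : Fin (n + 1)) : i.castSucc + 1 = i.succ := by
  ext
  have h : i.castSucc.val + 1 < n + 2 := by rw [Fin.val_castSucc]; omega
  rw [Fin.val_add_one_of_lt' h, Fin.val_castSucc, Fin.val_succ]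

/-- The entry in slot `j` after composing `aᵢ` and `aᵢ₊₁`. -/
def mergeEntry {n : ℕ} (X : Fin (n + 2) → C.Obj) (p : Fin (n + 2) → ℤ) (i j : Fin (n + 1))
    (a : ∀ c, Slot X p c) : Slot (mergeObj X i) (mergeDeg p i) j :=
  if h : j < i then
    C.castHom (congrArg X (merge_index_lt h).2.symm) (congrArg X (merge_index_lt h).1.symm)
      (by simp [mergeDeg, h]) (a j.castSucc)
  else if h' : j = i then
    C.castHom (congrArg X (by rw [h', merge_index_ge le_rfl]))
      (congrArg X (by rw [h', Fin.succAbove_of_castSucc_lt _ _ Fin.castSucc_lt_succ])) (by simp [mergeDeg, h'])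
      (C.comp rfl (C.castHom (congrArg X (castSucc_add_one i)) rfl rfl (a i.castSucc)) (a i.succ))
  else
    C.castHom (congrArg X (merge_index_ge (not_lt.1 h)).symm)
      (congrArg X (merge_index_gt (lt_of_le_of_ne (not_lt.1 h) (Ne.symm h'))).symm)
      (by simp [mergeDeg, h, h']) (a j.succ)

theorem mergeEntry_lt {n : ℕ} (X : Fin (n + 2) → C.Obj) (p : Fin (n + 2) → ℤ) {i j : Fin (n + 1)}
    (h : j < i) (a : ∀ c, Slot X p c) : mergeEntry X p i j a =
      C.castHom (congrArg X (merge_index_lt h).2.symm) (congrArg X (merge_index_lt h).1.symm)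
      (by simp [mergeDeg, h]) (a j.castSucc) := dif_pos h

theorem mergeEntry_self {n : ℕ} (X : Fin (n + 2) → C.Obj) (p : Fin (n + 2) → ℤ) (i : Fin (n + 1))
    (a : ∀ c, Slot X p c) : mergeEntry X p i i a =
      C.castHom (congrArg X (by rw [merge_index_ge le_rfl]))
      (congrArg X (by rw [Fin.succAbove_of_castSucc_lt _ _ Fin.castSucc_lt_succ]))
      (by simp [mergeDeg])
      (C.comp rfl (C.castHom (congrArg X (castSucc_add_one i)) rfl rfl (a i.castSucc))
        (a i.succ)) := by
  rw [mergeEntry, dif_neg (lt_irrefl i), dif_pos rfl]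

theorem mergeEntry_gt {n : ℕ} (X : Fin (n + 2) → C.Obj) (p : Fin (n + 2) → ℤ) {i j : Fin (n + 1)}
    (h : i < j) (a : ∀ c, Slot X p c) : mergeEntry X p i j a =
      C.castHom (congrArg X (merge_index_ge h.le).symm) (congrArg X (merge_index_gt h).symm)
      (by simp [mergeDeg, h.not_gt, h.ne']) (a j.succ) := by
  rw [mergeEntry, dif_neg h.not_gt, dif_neg h.ne']

theorem predAbove_cases {n : ℕ} {i j : Fin (n + 1)} {c : Fin (n + 2)} (hj : j = i.predAbove c) :
    (j < i ∧ c = j.castSucc) ∨ (j = i ∧ c = j.castSucc) ∨ (j = i ∧ c = j.succ) ∨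
      (i < j ∧ c = j.succ) := by
  subst hj
  rcases le_or_gt c i.castSucc with h | h
  · have e : (i.predAbove c).castSucc = c := by
      rw [Fin.predAbove_of_le_castSucc i c h, Fin.castSucc_castPred]
    have h2 : i.predAbove c ≤ i := Fin.castSucc_le_castSucc_iff.1 (e.le.trans h)
    rcases h2.lt_or_eq with h3 | h3
    · exact Or.inl ⟨h3, e.symm⟩
    · exact Or.inr (Or.inl ⟨h3, e.symm⟩)
  · have e : (i.predAbove c).succ = c := by
      rw [Fin.predAbove_of_castSucc_lt i c h, Fin.succ_pred]
    have h2 : i ≤ i.predAbove c := Fin.castSucc_lt_succ_iff.1 (h.trans_eq e.symm)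
    rcases h2.lt_or_eq with h3 | h3
    · exact Or.inr (Or.inr (Or.inr ⟨h3, e.symm⟩))
    · exact Or.inr (Or.inr (Or.inl ⟨h3.symm, e.symm⟩))

/-- Compose the entries in the slots `i` and `i + 1` (without sign):
`a₀[a₁|…|aₙ₊₁] ↦ a₀[a₁|…|aᵢaᵢ₊₁|…|aₙ₊₁]`. -/
def merge {n : ℕ} (X : Fin (n + 2) → C.Obj) (p : Fin (n + 2) → ℤ) (i : Fin (n + 1)) :
    Words X p →ₗ[k] Words (mergeObj X i) (mergeDeg p i) :=
  tensorOfFactors i.predAbove (fun j a => mergeEntry X p i j a)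
    (by
      intro a c x j hj
      rcases lt_trichotomy j i with h | rfl | h
      · rw [mergeEntry_lt _ _ h, mergeEntry_lt _ _ h, Function.update_of_ne]
        rintro rfl
        exact hj (Fin.predAbove_castSucc_of_le _ _ h.le).symm
      · rw [mergeEntry_self, mergeEntry_self, Function.update_of_ne, Function.update_of_ne]
        · rintro rfl; exact hj (Fin.predAbove_succ_self j).symm
        · rintro rfl; exact hj (Fin.predAbove_castSucc_self j).symm
      · rw [mergeEntry_gt _ _ h, mergeEntry_gt _ _ h, Function.update_of_ne]
        rintro rfl
        exact hj (Fin.predAbove_succ_of_le _ _ h.le).symm)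
    (by
      intro a c x y j hj
      rcases predAbove_cases hj with ⟨h, rfl⟩ | ⟨rfl, rfl⟩ | ⟨rfl, rfl⟩ | ⟨h, rfl⟩
      · simp only [mergeEntry_lt _ _ h, Function.update_self, map_add]
      · simp only [mergeEntry_self, Function.update_self, map_add, LinearMap.add_apply,
          Function.update_of_ne (Fin.castSucc_lt_succ (i := j)).ne']
      · simp only [mergeEntry_self, Function.update_self, map_add,
          Function.update_of_ne (Fin.castSucc_lt_succ (i := j)).ne]
      · simp only [mergeEntry_gt _ _ h, Function.update_self, map_add])
    (by
      intro a c s x j hj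
      rcases predAbove_cases hj with ⟨h, rfl⟩ | ⟨rfl, rfl⟩ | ⟨rfl, rfl⟩ | ⟨h, rfl⟩
      · simp only [mergeEntry_lt _ _ h, Function.update_self, map_smul]
      · simp only [mergeEntry_self, Function.update_self, map_smul, LinearMap.smul_apply,
          Function.update_of_ne (Fin.castSucc_lt_succ (i := j)).ne']
      · simp only [mergeEntry_self, Function.update_self, map_smul,
          Function.update_of_ne (Fin.castSucc_lt_succ (i := j)).ne]
      · simp only [mergeEntry_gt _ _ h, Function.update_self, map_smul])

/-- Cyclic rotation `a₀ ⊗ a₁ ⊗ … ⊗ aₙ ↦ aₙ ⊗ a₀ ⊗ … ⊗ aₙ₋₁` (without sign). -/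
def rotate {n : ℕ} (X : Fin (n + 1) → C.Obj) (p : Fin (n + 1) → ℤ) :
    Words X p →ₗ[k] Words (C := C) (fun j => X (j - 1)) (fun j => p (j - 1)) :=
  tensorOfFactors (fun c => c + 1)
    (fun j a => C.castHom (congrArg X (by rw [sub_add_cancel, add_sub_cancel_right])) rfl rfl
      (a (j - 1)))
    (by
      intro a c x j hj
      rw [Function.update_of_ne]
      rintro rfl
      exact hj (by simp))
    (by
      intro a c x y j hj
      obtain rfl : j - 1 = c := by rw [hj, add_sub_cancel_right]
      simp only [Function.update_self, map_add])
    (by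
      intro a c s x j hj
      obtain rfl : j - 1 = c := by rw [hj, add_sub_cancel_right]
      simp only [Function.update_self, map_smul])

/-- `etaDeg p i = |a₀| + |sa₁| + … + |saᵢ|` for `|aⱼ| = p j`, where `|sa| = |a| - 1`. -/
def etaDeg {n : ℕ} (p : Fin (n + 1) → ℤ) (i : ℕ) : ℤ :=
  ∑ j : Fin (n + 1), if j.val = 0 then p j else if j.val ≤ i then p j - 1 else 0

/-- The part `b₀` of the Hochschild differential: on `a₀[a₁|…|aₙ]` it is
`da₀[a₁|…|aₙ] - ∑_{1 ≤ i ≤ n} (-1)^{η_{i-1}} a₀[a₁|…|daᵢ|…|aₙ]`. -/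
def b0 {n : ℕ} (X : Fin (n + 1) → C.Obj) (p : Fin (n + 1) → ℤ) : Words X p →ₗ[k] Chains C :=
  incl _ _ ∘ₗ dAt X p 0 -
    ∑ i : Fin n, (etaDeg p i.val).negOnePow • (incl _ _ ∘ₗ dAt X p i.succ)

/-- The part `b₁` of the Hochschild differential: it vanishes on `a₀`, and on `a₀[a₁|…|aₙ]` with
`1 ≤ n` it is `∑_{0 ≤ i < n} (-1)^{η_i} a₀[a₁|…|aᵢaᵢ₊₁|…|aₙ]`, where `i = 0` stands for
`(-1)^{|a₀|} a₀a₁[a₂|…|aₙ]`, minus `(-1)^{η_{n-1}(|aₙ|+1)} aₙa₀[a₁|…|aₙ₋₁]`. -/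
def b1 : {n : ℕ} → (X : Fin (n + 1) → C.Obj) → (p : Fin (n + 1) → ℤ) → Words X p →ₗ[k] Chains C
  | 0, _, _ => 0
  | n + 1, X, p =>
    (∑ i : Fin (n + 1), (etaDeg p i.val).negOnePow • (incl _ _ ∘ₗ merge X p i)) -
      (etaDeg p n * (p (Fin.last (n + 1)) + 1)).negOnePow •
        (incl _ _ ∘ₗ merge (fun j => X (j - 1)) (fun j => p (j - 1)) 0 ∘ₗ rotate X p)

open Classical in
/-- The Hochschild differential `b = b₀ + b₁`. -/
def b (C : DGCategory.{u, v, w} k) : Chains C →ₗ[k] Chains C :=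
  DirectSum.toModule k C.Cycle (Chains C) (fun c => b0 c.obj c.deg + b1 c.obj c.deg)

theorem b_incl {n : ℕ} (X : Fin (n + 1) → C.Obj) (p : Fin (n + 1) → ℤ) (x : Words X p) :
    b C (incl X p x) = b0 X p x + b1 X p x := by
  classical
  exact DirectSum.toModule_lof (M := fun c : C.Cycle => Words c.obj c.deg) k ⟨n, X, p⟩ x

/-- The chains of degree `m`: those with components only in words `a₀[a₁|…|aₙ]` of degree
`|a₀| + |sa₁| + … + |saₙ| = m`. -/
def chainsOfDegree (C : DGCategory.{u, v, w} k) (m : ℤ) : Submodule k (Chains C) :=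
  ⨅ (c : C.Cycle) (_ : etaDeg c.deg c.n ≠ m), LinearMap.ker (component c)

/-- The Hochschild cycles of degree `m`. -/
def cycles (C : DGCategory.{u, v, w} k) (m : ℤ) : Submodule k (Chains C) :=
  chainsOfDegree C m ⊓ LinearMap.ker (b C)

/-- The Hochschild boundaries of degree `m`. -/
def boundaries (C : DGCategory.{u, v, w} k) (m : ℤ) : Submodule k (Chains C) :=
  (chainsOfDegree C (m - 1)).map (b C)

/-- The Hochschild homology `HH_m(C) = H^m(C_•(C))`. -/
abbrev HH (C : DGCategory.{u, v, w} k) (m : ℤ) : Type (max u v w) :=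
  cycles C m ⧸ (boundaries C m).submoduleOf (cycles C m)

/-- An endomorphism of degree `0`, as a Hochschild chain `a₀` (with `n = 0`). -/
def endChain (C : DGCategory.{u, v, w} k) (X : C.Obj) (f : C.Hom X X 0) : Chains C :=
  incl (n := 0) (fun _ => X) (fun _ => 0) (PiTensorProduct.tprod k (fun _ => f))

theorem endChain_mem (C : DGCategory.{u, v, w} k) (X : C.Obj) (f : C.Hom X X 0)
    (hf : C.d (zero_add 1) f = 0) : endChain C X f ∈ cycles C 0 := by
  classical
  refine Submodule.mem_inf.2 ⟨?_, ?_⟩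
  · refine (Submodule.mem_iInf _).2 fun c => (Submodule.mem_iInf _).2 fun hc => ?_
    rw [LinearMap.mem_ker]
    refine DFinsupp.single_eq_of_ne (β := fun c : C.Cycle => Words c.obj c.deg) ?_
    rintro rfl
    exact hc (by simp [etaDeg])
  · rw [LinearMap.mem_ker, endChain, b_incl]
    have h : dAt (C := C) (n := 0) (fun _ => X) (fun _ => 0) 0
        (PiTensorProduct.tprod k (fun _ => f)) = 0 := by
      rw [dAt, PiTensorProduct.map_tprod]
      refine MultilinearMap.map_coord_zero _ 0 ?_
      rw [dif_pos rfl]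
      have aux : ∀ (m : ℤ) (hm : 0 + 1 = m), C.d hm f = 0 := by
        intro m hm
        have : (1 : ℤ) = m := by omega
        subst this
        exact hf
      exact aux _ _
    simp [b0, b1, h]

end DGCategory

open DGCategory

/-! ### The DG category of right DG modules, shifts and cones -/

section Modules

variable {A : DGAlgebra.{u, v} k}

/-- The morphisms `M → N` of degree `n`: the `A`-linear maps that raise degrees by `n`. -/
def DGModule.homDeg (M N : DGModule A) (n : ℤ) : Submodule k (M.carrier →ₗ[k] N.carrier) where
  carrier := {f | (∀ (a : A.carrier) (m : M.carrier),
      f (MulOpposite.op a • m) = MulOpposite.op a • f m) ∧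
    ∀ (i : ℤ) (m : M.carrier), m ∈ M.gr i → f m ∈ N.gr (i + n)}
  zero_mem' := ⟨fun a m => by simp, fun i m _ => by simp⟩
  add_mem' hf hg := ⟨fun a m => by simp [hf.1, hg.1],
    fun i m hm => add_mem (hf.2 i m hm) (hg.2 i m hm)⟩
  smul_mem' c f hf := ⟨fun a m => by
      rw [LinearMap.smul_apply, LinearMap.smul_apply, hf.1, smul_comm], fun i m hm =>
    Submodule.smul_mem _ c (hf.2 i m hm)⟩

theorem DGModule.induction_gr (M : DGModule A) {P : M.carrier → Prop} (m : M.carrier)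
    (h0 : P 0) (hom : ∀ (i : ℤ) (x : M.carrier), x ∈ M.gr i → P x)
    (add : ∀ x y, P x → P y → P (x + y)) : P m := by
  have h : m ∈ ⨆ i, M.gr i := by
    rw [M.isInternal.submodule_iSup_eq_top]
    trivial
  exact Submodule.iSup_induction _ (motive := P) h hom h0 add

theorem smul_sign_mem {M : Type v} [AddCommGroup M] [Module k M] (S : Submodule k M) (n : ℤ)
    {x : M} (hx : x ∈ S) : n.negOnePow • x ∈ S := by
  rcases Int.even_or_odd n with h | h
  · simpa [Int.negOnePow_even n h] using hx
  · simpa [Int.negOnePow_odd n h] using hx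

/-- The differential of `Hom(M, N)`: `f ↦ d_N f - (-1)ⁿ f d_M` for `f` of degree `n`. -/
def DGModule.homD (M N : DGModule A) {n m : ℤ} (h : n + 1 = m) :
    M.homDeg N n →ₗ[k] M.homDeg N m :=
  LinearMap.restrict
    ((LinearMap.llcomp k M.carrier N.carrier N.carrier N.d) -
      n.negOnePow • (LinearMap.lcomp k N.carrier M.d))
    (by
      intro f hf
      subst h
      refine ⟨fun a m => ?_, fun i m hm => ?_⟩
      · change N.d (f (MulOpposite.op a • m)) - n.negOnePow • f (M.d (MulOpposite.op a • m)) =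
          MulOpposite.op a • (N.d (f m) - n.negOnePow • f (M.d m))
        refine M.induction_gr (P := fun m =>
          N.d (f (MulOpposite.op a • m)) - n.negOnePow • f (M.d (MulOpposite.op a • m)) =
          MulOpposite.op a • (N.d (f m) - n.negOnePow • f (M.d m))) m (by simp)
          (fun i x hx => ?_) (fun x y hx hy => ?_)
        · rw [hf.1, N.d_smul a (hf.2 i x hx), M.d_smul a hx, Int.negOnePow_add]
          rcases Int.units_eq_one_or n.negOnePow with h1 | h1 <;>
          rcases Int.units_eq_one_or i.negOnePow with h2 | h2 <;>
          simp [h1, h2, hf.1, smul_sub]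
        · simp only [smul_add, smul_sub, map_add] at hx hy ⊢
          rw [add_sub_add_comm, hx, hy, add_sub_add_comm]
      · refine sub_mem ?_ ?_
        · have := N.d_mem (hf.2 i m hm)
          rwa [add_assoc] at this
        · refine smul_sign_mem _ _ ?_
          have := hf.2 _ _ (M.d_mem hm)
          rwa [add_assoc, add_comm 1 n] at this)

theorem DGModule.homD_apply (M N : DGModule A) {n m : ℤ} (h : n + 1 = m) (f : M.homDeg N n)
    (x : M.carrier) : (M.homD N h f).1 x = N.d (f.1 x) - n.negOnePow • f.1 (M.d x) := by
  simp [homD]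

/-- Composition of morphisms of DG modules. -/
def DGModule.homComp (L M N : DGModule A) {m n p : ℤ} (h : m + n = p) :
    M.homDeg N m →ₗ[k] L.homDeg M n →ₗ[k] L.homDeg N p :=
  LinearMap.mk₂ k (fun f g => ⟨f.1 ∘ₗ g.1, fun a x => by simp [f.2.1, g.2.1], fun i x hx => by
      have := f.2.2 _ _ (g.2.2 i x hx)
      rwa [add_assoc, add_comm n m, h] at this⟩)
    (fun f f' g => by ext; simp) (fun c f g => by ext; simp)
    (fun f g g' => by ext; simp) (fun c f g => by ext; simp)

/-- The DG category `Mod A` of right DG `A`-modules. -/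
abbrev Mod (A : DGAlgebra.{u, v} k) : DGCategory.{u, max u (v + 1), v} k where
  Obj := DGModule A
  Hom M N n := M.homDeg N n
  d h := DGModule.homD _ _ h
  comp h := DGModule.homComp _ _ _ h
  one M := ⟨LinearMap.id, fun a m => rfl, fun i m hm => by simpa using hm⟩
  d_d h h' f := by
    subst h h'
    ext x
    simp [DGModule.homD_apply, DGModule.d_d, Int.negOnePow_succ]
  one_comp f := by ext x; rfl
  comp_one f := by ext x; rfl
  comp_assoc h₁ h₂ h₃ h₄ f g e := by ext x; rfl
  leibniz h hm hn hp h₁ h₂ f g := by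
    subst h
    ext x
    simp [DGModule.homD_apply, DGModule.homComp, Int.negOnePow_add, smul_sub, smul_smul]

/-- The shift `M[1]`: `M[1]ⁿ = Mⁿ⁺¹`, with differential `-d` and the same right action. -/
def DGModule.shift (M : DGModule A) : DGModule A where
  carrier := M.carrier
  gr n := M.gr (n + 1)
  isInternal := by
    rw [DirectSum.isInternal_submodule_iff_iSupIndep_and_iSup_eq_top]
    refine ⟨M.isInternal.submodule_iSupIndep.comp (add_left_injective 1), ?_⟩
    rw [← M.isInternal.submodule_iSup_eq_top]
    exact (Equiv.addRight (1 : ℤ)).iSup_comp (g := M.gr)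
  smul_mem {i j m a} hm ha := by
    have := M.smul_mem hm ha
    rwa [add_right_comm] at this
  d := -M.d
  d_mem hm := neg_mem (M.d_mem hm)
  d_d m := by simp [M.d_d]
  d_smul {i m} a hm := by
    rw [LinearMap.neg_apply, LinearMap.neg_apply, M.d_smul a hm, Int.negOnePow_succ]
    simp [add_comm]

theorem isInternal_prod {V W : Type v} [AddCommGroup V] [Module k V] [AddCommGroup W] [Module k W]
    {F : ℤ → Submodule k V} {G : ℤ → Submodule k W} (hF : DirectSum.IsInternal F)
    (hG : DirectSum.IsInternal G) : DirectSum.IsInternal (fun n => (F n).prod (G n)) := by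
  rw [DirectSum.isInternal_submodule_iff_iSupIndep_and_iSup_eq_top]
  constructor
  · intro i
    rw [Submodule.disjoint_def]
    intro x hx hx'
    have h : (⨆ (j : ℤ) (_ : j ≠ i), (F j).prod (G j)) ≤
        (⨆ (j : ℤ) (_ : j ≠ i), F j).prod (⨆ (j : ℤ) (_ : j ≠ i), G j) :=
      iSup₂_le fun j hj => Submodule.prod_mono
        (le_iSup₂_of_le j hj le_rfl) (le_iSup₂_of_le j hj le_rfl)
    exact Prod.ext
      (Submodule.disjoint_def.1 (hF.submodule_iSupIndep i) x.1 hx.1 (h hx').1)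
      (Submodule.disjoint_def.1 (hG.submodule_iSupIndep i) x.2 hx.2 (h hx').2)
  · have h1 : (⨆ n, F n) ≤ (⨆ n, (F n).prod (G n)).comap (LinearMap.inl k V W) :=
      iSup_le fun n x hx => Submodule.mem_iSup_of_mem n ⟨hx, zero_mem _⟩
    have h2 : (⨆ n, G n) ≤ (⨆ n, (F n).prod (G n)).comap (LinearMap.inr k V W) :=
      iSup_le fun n x hx => Submodule.mem_iSup_of_mem n ⟨zero_mem _, hx⟩
    rw [hF.submodule_iSup_eq_top] at h1
    rw [hG.submodule_iSup_eq_top] at h2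
    rw [eq_top_iff]
    rintro ⟨x, y⟩ -
    have := add_mem (Submodule.mem_comap.1 (h1 (Submodule.mem_top (R := k) (x := x))))
      (Submodule.mem_comap.1 (h2 (Submodule.mem_top (R := k) (x := y))))
    rwa [LinearMap.inl_apply, LinearMap.inr_apply, Prod.mk_add_mk, add_zero, zero_add] at this

theorem closed_apply {L M : DGModule A} (p : L.homDeg M 0) (hp : (Mod A).d (zero_add 1) p = 0)
    (x : L.carrier) : p.1 (L.d x) = M.d (p.1 x) := by
  have h := DGModule.homD_apply L M (zero_add 1) p x
  rw [show DGModule.homD L M (zero_add 1) p = 0 from hp, Int.negOnePow_zero, one_smul] at h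
  exact (sub_eq_zero.1 h.symm).symm

theorem closed_of_apply {L M : DGModule A} (p : L.homDeg M 0)
    (h : ∀ x, p.1 (L.d x) = M.d (p.1 x)) : (Mod A).d (zero_add 1) p = 0 := by
  refine Subtype.ext (LinearMap.ext fun x => ?_)
  refine (DGModule.homD_apply L M (zero_add 1) p x).trans ?_
  rw [Int.negOnePow_zero, one_smul, h, sub_self]
  rfl

/-- The cone of a closed morphism `p : L → M` of degree `0`: the graded module `L[1] ⊕ M` with the
differential `(l, m) ↦ (-d l, p l + d m)`. -/
def DGModule.cone {L M : DGModule A} (p : L.homDeg M 0) (hp : (Mod A).d (zero_add 1) p = 0) :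
    DGModule A where
  carrier := L.carrier × M.carrier
  tower := ⟨fun c a x => Prod.ext (smul_assoc c a x.1) (smul_assoc c a x.2)⟩
  gr n := (L.gr (n + 1)).prod (M.gr n)
  isInternal := isInternal_prod L.shift.isInternal M.isInternal
  smul_mem hm ha := ⟨L.shift.smul_mem hm.1 ha, M.smul_mem hm.2 ha⟩
  d :=
    { toFun := fun x => (-L.d x.1, p.1 x.1 + M.d x.2)
      map_add' := fun x y => Prod.ext (by simp [add_comm]) (by simp [add_add_add_comm])
      map_smul' := fun c x => Prod.ext (by simp) (by simp) }
  d_mem {i x} hx := ⟨neg_mem (L.d_mem hx.1), add_mem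
    (by simpa using p.2.2 _ _ hx.1) (M.d_mem hx.2)⟩
  d_d x := by
    refine Prod.ext ?_ ?_
    · change -L.d (-L.d x.1) = 0
      rw [map_neg, L.d_d, neg_zero, neg_zero]
    · change p.1 (-L.d x.1) + M.d (p.1 x.1 + M.d x.2) = 0
      rw [map_neg, map_add, M.d_d, closed_apply p hp, add_zero, neg_add_cancel]
  d_smul {i x} a hx := by
    refine Prod.ext (L.shift.d_smul a hx.1) ?_
    change p.1 (MulOpposite.op a • x.1) + M.d (MulOpposite.op a • x.2) =
      MulOpposite.op a • (p.1 x.1 + M.d x.2) + i.negOnePow • MulOpposite.op (A.d a) • x.2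
    rw [M.d_smul a hx.2, p.2.1, smul_add, add_assoc]

/-- The inclusion `q : M → Cone(p)`. -/
def coneInr {L M : Z0 (Mod A)} (p : L ⟶ M) :
    M ⟶ (⟨DGModule.cone p.val p.closed⟩ : Z0 (Mod A)) where
  val := ⟨LinearMap.inr k L.as.carrier M.as.carrier,
    fun a m => Prod.ext (smul_zero _).symm rfl,
    fun i m hm => ⟨zero_mem _, by rw [add_zero]; exact hm⟩⟩
  closed := closed_of_apply _ fun x => by
    change ((0 : L.as.carrier), M.as.d x) = (-L.as.d 0, p.val.1 0 + M.as.d x)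
    simp

/-- The projection `r : Cone(p) → L[1]`. -/
def coneFst {L M : Z0 (Mod A)} (p : L ⟶ M) :
    (⟨DGModule.cone p.val p.closed⟩ : Z0 (Mod A)) ⟶ ⟨L.as.shift⟩ where
  val := ⟨LinearMap.fst k L.as.carrier M.as.carrier, fun a m => rfl,
    fun i m hm => by rw [add_zero]; exact hm.1⟩
  closed := closed_of_apply _ fun x => rfl

/-- The shift functor on DG modules and closed morphisms of degree `0`: a morphism `f` is sent to
the same map `f`, as a morphism `M[1] → N[1]`. -/
def shiftZ0 (A : DGAlgebra.{u, v} k) : Z0 (Mod A) ⥤ Z0 (Mod A) where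
  obj M := ⟨M.as.shift⟩
  map {M N} f :=
    { val := ⟨f.val.1, f.val.2.1, fun i m hm => by
        have := f.val.2.2 (i + 1) m hm
        rwa [add_right_comm] at this⟩
      closed := closed_of_apply _ fun x =>
        (map_neg f.val.1 _).trans (congrArg Neg.neg (closed_apply f.val f.closed x)) }
  map_id M := rfl
  map_comp f g := rfl

/-- The shift functor on `Ho(Mod A)`. -/
def shiftHo (A : DGAlgebra.{u, v} k) : Ho (Mod A) ⥤ Ho (Mod A) :=
  CategoryTheory.Quotient.lift _ (shiftZ0 A ⋙ (Mod A).homClass) (by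
    rintro X Y f g ⟨h, e⟩
    refine CategoryTheory.Quotient.sound _ ⟨⟨-h.1, fun a m => ?_, fun i m hm => ?_⟩, ?_⟩
    · exact (congrArg Neg.neg (h.2.1 a m)).trans (smul_neg _ _).symm
    · have := h.2.2 (i + 1) m hm
      rw [add_right_comm] at this
      exact neg_mem this
    · refine Subtype.ext (LinearMap.ext fun x => ?_)
      have e' := congrArg (fun t => t.1 x) e
      refine (e'.trans (DGModule.homD_apply X.as Y.as (neg_add_cancel 1) h x)).trans
        (Eq.trans ?_ (DGModule.homD_apply X.as.shift Y.as.shift (neg_add_cancel 1) _ x).symm)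
      change Y.as.d (h.1 x) - (-1 : ℤ).negOnePow • h.1 (X.as.d x) =
        -Y.as.d (-h.1 x) - (-1 : ℤ).negOnePow • -h.1 (-X.as.d x)
      simp)

/-! ### Distinguished triangles and perfect modules -/

/-- A triangle `X → Y → Z → X[1]` in `Ho(Mod A)` is distinguished if it is isomorphic to
`L → M → Cone(p) → L[1]` for some closed morphism `p : L → M` of degree `0`. -/
def IsDistinguished {X Y Z : Ho (Mod A)} (f : X ⟶ Y) (g : Y ⟶ Z) (h : Z ⟶ (shiftHo A).obj X) :
    Prop :=
  ∃ (L M : Z0 (Mod A)) (p : L ⟶ M)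
    (e₁ : X ≅ (Mod A).homClass.obj L) (e₂ : Y ≅ (Mod A).homClass.obj M)
    (e₃ : Z ≅ (Mod A).homClass.obj ⟨DGModule.cone p.val p.closed⟩),
    f ≫ e₂.hom = e₁.hom ≫ (Mod A).homClass.map p ∧
    g ≫ e₃.hom = e₂.hom ≫ (Mod A).homClass.map (coneInr p) ∧
    h ≫ (shiftHo A).map e₁.hom = e₃.hom ≫ (Mod A).homClass.map (coneFst p)

/-- `N` is finitely generated free, i.e. isomorphic to `K ⊗ A` for a finite dimensional graded
vector space `K`: it has a finite `A`-basis of closed homogeneous elements. -/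
def DGModule.IsFGFree (N : DGModule A) : Prop :=
  ∃ (r : ℕ) (e : Module.Basis (Fin r) A.carrierᵐᵒᵖ N.carrier),
    ∀ i, (∃ n, e i ∈ N.gr n) ∧ N.d (e i) = 0

/-- `N` is finitely generated semi-free: it is obtained, up to isomorphism of DG modules, from
finitely generated free modules by successively taking cones of closed morphisms of degree `0`. -/
inductive DGModule.IsSemiFree : DGModule A → Prop
  | free (N : DGModule A) : N.IsFGFree → DGModule.IsSemiFree N
  | cone {L M : DGModule A} (p : L.homDeg M 0) (hp : (Mod A).d (zero_add 1) p = 0) :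
      DGModule.IsSemiFree L → DGModule.IsSemiFree M → DGModule.IsSemiFree (DGModule.cone p hp)
  | iso {M N : Z0 (Mod A)} (e : M ≅ N) : DGModule.IsSemiFree M.as → DGModule.IsSemiFree N.as

/-- `L` is a homotopy direct summand of `N`: there is a homotopy idempotent `π : N → N` that splits
in `Ho(Mod A)` through `L`. -/
def DGModule.IsHomotopySummand (L N : DGModule A) : Prop :=
  ∃ (π : (Mod A).toHo N ⟶ (Mod A).toHo N) (f : (Mod A).toHo N ⟶ (Mod A).toHo L)
    (g : (Mod A).toHo L ⟶ (Mod A).toHo N), π ≫ π = π ∧ g ≫ f = 𝟙 _ ∧ f ≫ g = π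

/-- Perfect modules: the homotopy direct summands of finitely generated semi-free modules. -/
def DGModule.IsPerfect (N : DGModule A) : Prop :=
  ∃ S : DGModule A, S.IsSemiFree ∧ N.IsHomotopySummand S

theorem DGModule.IsFGFree.shift {N : DGModule A} (h : N.IsFGFree) : N.shift.IsFGFree := by
  obtain ⟨r, e, he⟩ := h
  refine ⟨r, e, fun i => ⟨?_, ?_⟩⟩
  · obtain ⟨n, hn⟩ := (he i).1
    refine ⟨n - 1, ?_⟩
    change e i ∈ N.gr (n - 1 + 1)
    rwa [sub_add_cancel]
  · change -N.d (e i) = 0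
    rw [(he i).2, neg_zero]

theorem DGModule.IsSemiFree.shift {N : DGModule A} (h : N.IsSemiFree) : N.shift.IsSemiFree := by
  induction h with
  | free N h => exact .free _ h.shift
  | iso e h ih => exact .iso ((shiftZ0 A).mapIso e) ih
  | @cone L M p hp _ _ ihL ihM =>
    let q : (⟨L⟩ : Z0 (Mod A)) ⟶ ⟨M⟩ := ⟨-p, by rw [map_neg, hp, neg_zero]⟩
    let q' := (shiftZ0 A).map q
    let S := DGModule.cone q'.val q'.closed
    let T := (DGModule.cone p hp).shift
    have hd : ∀ x, S.d x = T.d x := fun x => by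
      refine Prod.ext rfl ?_
      change -p.1 x.1 + -M.d x.2 = -(p.1 x.1 + M.d x.2)
      rw [neg_add]
    let e : (⟨S⟩ : Z0 (Mod A)) ≅ ⟨T⟩ :=
      { hom := ⟨⟨LinearMap.id, fun _ _ => rfl, fun i m hm => by
            rw [add_zero]; exact hm⟩, closed_of_apply _ hd⟩
        inv := ⟨⟨LinearMap.id, fun _ _ => rfl, fun i m hm => by
            rw [add_zero]; exact hm⟩, closed_of_apply _ fun x => (hd x).symm⟩
        hom_inv_id := rfl
        inv_hom_id := rfl }
    exact .iso e (.cone _ q'.closed ihL ihM)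

theorem DGModule.IsPerfect.shift {N : DGModule A} (h : N.IsPerfect) : N.shift.IsPerfect := by
  obtain ⟨S, hS, π, f, g, h1, h2, h3⟩ := h
  refine ⟨S.shift, hS.shift, (shiftHo A).map π, (shiftHo A).map f, (shiftHo A).map g, ?_, ?_, ?_⟩
  · exact ((shiftHo A).map_comp π π).symm.trans (congrArg _ h1)
  · exact ((shiftHo A).map_comp g f).symm.trans ((congrArg _ h2).trans ((shiftHo A).map_id _))
  · exact ((shiftHo A).map_comp f g).symm.trans (congrArg _ h3)

/-! ### The DG category of perfect modules, its Grothendieck group and the Euler class -/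

/-- The DG category `Perf A` of perfect right DG `A`-modules, a full subcategory of `Mod A`. -/
abbrev Perf (A : DGAlgebra.{u, v} k) : DGCategory.{u, max u (v + 1), v} k :=
  (Mod A).fullSub DGModule.IsPerfect

/-- The inclusion `Ho(Perf A) ⥤ Ho(Mod A)`. -/
def perfInclusion (A : DGAlgebra.{u, v} k) : Ho (Perf A) ⥤ Ho (Mod A) :=
  CategoryTheory.Quotient.lift _
    (({ obj := fun N => ⟨N.as.1⟩
        map := fun f => Z0.Hom.mk f.val f.closed } : Z0 (Perf A) ⥤ Z0 (Mod A)) ⋙ (Mod A).homClass)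
    (fun _ _ _ _ ⟨h, e⟩ => CategoryTheory.Quotient.sound _ ⟨h, e⟩)

/-- The shift `N[1]` of a perfect module. -/
def shiftPerf (N : (Perf A).Obj) : (Perf A).Obj := ⟨N.1.shift, N.2.shift⟩

/-- A triangle `L → M → N → L[1]` in `Ho(Perf A)` is distinguished if it is distinguished in
`Ho(Mod A)`. -/
def IsPerfDistinguished {L M N : (Perf A).Obj} (p : (Perf A).toHo L ⟶ (Perf A).toHo M)
    (q : (Perf A).toHo M ⟶ (Perf A).toHo N) (r : (Perf A).toHo N ⟶ (Perf A).toHo (shiftPerf L)) :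
    Prop :=
  IsDistinguished ((perfInclusion A).map p) ((perfInclusion A).map q) ((perfInclusion A).map r)

/-- The relations `[M] = [L] + [N]` for all distinguished triangles `L → M → N → L[1]`. -/
def K0Relations (A : DGAlgebra.{u, v} k) : AddSubgroup (FreeAbelianGroup (Perf A).Obj) :=
  AddSubgroup.closure {x | ∃ (L M N : (Perf A).Obj) (p : (Perf A).toHo L ⟶ (Perf A).toHo M)
    (q : (Perf A).toHo M ⟶ (Perf A).toHo N) (r : (Perf A).toHo N ⟶ (Perf A).toHo (shiftPerf L)),
    IsPerfDistinguished p q r ∧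
      x = FreeAbelianGroup.of M - (FreeAbelianGroup.of L + FreeAbelianGroup.of N)}

/-- The Grothendieck group of the triangulated category `Ho(Perf A)`. -/
abbrev K0 (A : DGAlgebra.{u, v} k) : Type (max u (v + 1)) :=
  FreeAbelianGroup (Perf A).Obj ⧸ K0Relations A

/-- The class of a perfect module in the Grothendieck group. -/
def K0.mk (N : (Perf A).Obj) : K0 A := QuotientAddGroup.mk (FreeAbelianGroup.of N)

/-- The Euler class of a perfect module `N`: the class of the identity `1_N` in `HH₀(Perf A)`. -/
def Eu (N : (Perf A).Obj) : HH (Perf A) 0 :=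
  Submodule.Quotient.mk
    ⟨endChain (Perf A) N ((Perf A).one N), endChain_mem _ _ _ ((Perf A).d_one N _)⟩

end Modules

end DG
end

noncomputable section

namespace DG.DGCategory

variable {k : Type u} [Field k] {C : DGCategory.{u, v, w} k}

/-! Every identity in `HH 0` is obtained by exhibiting a chain of degree -1 whose Hochschild
boundary is the required difference; words of length at most three suffice. A homotopy `h`, viewed
as a word of length one, has boundary `d h`, and for closed `f`, `g` of degree 0 the word `f[g]` has
boundary `fg - gf`. So the class of a closed endomorphism depends only on its homotopy class and has
the trace property, and the class of an identity is a homotopy invariant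
(`endClass_one_eq_of_homotopyRel`).

For the shift, the identity map gives closed inverse morphisms `s : N[1] → N` and `t : N → N[1]` of
degrees 1 and -1, and the boundary of `s[t]` is `-(1_N + 1_{N[1]})` (`endClass_one_eq_neg`).

For a cone `E` of `p : L → M`, put `K = L[1]`. As a graded module `E` is `K ⊕ M`, with inclusions
`i`, `j` and projections `r`, `t`. Here `j` and `r` are closed, while `d i = jc` and `d t = -cr`,
where `c : K → M` is `p` regarded as a morphism of degree 1. The boundary of `i[r] + j[t]` is `1_E -
1_K - 1_M` plus the defect `(jc)[r] + j[cr]`, and this defect is the boundary of `j[c|r]` because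
`rj = 0` (`endClass_one_eq_add`). With the shift formula and homotopy invariance this yields
additivity on all distinguished triangles, hence the factorisation through `K0`. -/

/-! ### Transport of morphisms and comparison of words -/

theorem castHom_heq {X X' Y Y' : C.Obj} {n n' : ℤ} (hX : X = X') (hY : Y = Y') (hn : n = n')
    (f : C.Hom X Y n) : HEq (C.castHom hX hY hn f) f := by
  subst hX hY hn
  rfl

theorem comp_heq {X X' Y Y' Z Z' : C.Obj} {m m' n n' q q' : ℤ} (hX : X = X') (hY : Y = Y')
    (hZ : Z = Z') (hm : m = m') (hn : n = n') {f : C.Hom Y Z m} {f' : C.Hom Y' Z' m'}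
    {g : C.Hom X Y n} {g' : C.Hom X' Y' n'} (hf : HEq f f') (hg : HEq g g')
    (h : m + n = q) (h' : m' + n' = q') : HEq (C.comp h f g) (C.comp h' f' g') := by
  subst hX hY hZ hm hn h h'
  cases hf
  cases hg
  rfl

theorem d_heq {X X' Y Y' : C.Obj} {n n' m m' : ℤ} (hX : X = X') (hY : Y = Y')
    (hn : n = n') {f : C.Hom X Y n} {f' : C.Hom X' Y' n'} (hf : HEq f f')
    (h : n + 1 = m) (h' : n' + 1 = m') : HEq (C.d h f) (C.d h' f') := by
  subst hX hY hn h h'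
  cases hf
  rfl

/-- The type of a word depends on its objects and degrees, and `dAt`, `merge` and `rotate` produce
these only up to propositional equality. Entrywise `HEq` is what allows their output to be
identified with an explicit short word. -/
theorem incl_tprod_congr {n : ℕ} {X X' : Fin (n + 1) → C.Obj} {p p' : Fin (n + 1) → ℤ}
    (hX : X = X') (hp : p = p') {a : ∀ i, Slot X p i} {a' : ∀ i, Slot X' p' i}
    (ha : ∀ i, HEq (a i) (a' i)) :
    incl X p (PiTensorProduct.tprod k a) = incl X' p' (PiTensorProduct.tprod k a') := by
  subst hX hp
  rw [show a = a' from funext fun i => eq_of_heq (ha i)]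

theorem incl_mem_chainsOfDegree {n : ℕ} (X : Fin (n + 1) → C.Obj) (p : Fin (n + 1) → ℤ)
    (x : Words X p) {m : ℤ} (h : etaDeg p n = m) : incl X p x ∈ chainsOfDegree C m := by
  classical
  refine (Submodule.mem_iInf _).2 fun c => (Submodule.mem_iInf _).2 fun hc => ?_
  rw [LinearMap.mem_ker]
  refine DFinsupp.single_eq_of_ne (β := fun c : C.Cycle => Words c.obj c.deg) ?_
  rintro rfl
  exact hc h

/-! ### Words of length one, two and three -/

/-- The entries of a word of length two. -/
def entries₂ {X Y : C.Obj} {m n : ℤ} (f : C.Hom Y X m) (g : C.Hom X Y n) :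
    ∀ i, Slot ![X, Y] ![m, n] i
  | 0 => f
  | 1 => g

/-- The entries of a word of length three. -/
def entries₃ {X Y Z : C.Obj} {l m n : ℤ} (f : C.Hom Y X l) (g : C.Hom Z Y m) (h : C.Hom X Z n) :
    ∀ i, Slot ![X, Y, Z] ![l, m, n] i
  | 0 => f
  | 1 => g
  | 2 => h

/-- The chain `f`, of length one. -/
def word₁ {X : C.Obj} {m : ℤ} (f : C.Hom X X m) : Chains C :=
  incl (n := 0) (fun _ => X) (fun _ => m) (PiTensorProduct.tprod k (fun _ => f))

/-- The chain `f[g]`. -/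
def word₂ {X Y : C.Obj} {m n : ℤ} (f : C.Hom Y X m) (g : C.Hom X Y n) : Chains C :=
  incl ![X, Y] ![m, n] (PiTensorProduct.tprod k (entries₂ f g))

/-- The chain `f[g|h]`. -/
def word₃ {X Y Z : C.Obj} {l m n : ℤ} (f : C.Hom Y X l) (g : C.Hom Z Y m) (h : C.Hom X Z n) :
    Chains C :=
  incl ![X, Y, Z] ![l, m, n] (PiTensorProduct.tprod k (entries₃ f g h))

theorem word₁_mem {X : C.Obj} {m q : ℤ} (f : C.Hom X X m) (h : m = q) :
    word₁ f ∈ chainsOfDegree C q :=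
  incl_mem_chainsOfDegree _ _ _ (by simpa [etaDeg] using h)

theorem word₂_mem {X Y : C.Obj} {m n q : ℤ} (f : C.Hom Y X m) (g : C.Hom X Y n)
    (h : m + (n - 1) = q) : word₂ f g ∈ chainsOfDegree C q :=
  incl_mem_chainsOfDegree _ _ _ (by simpa [etaDeg, Fin.sum_univ_succ] using h)

theorem word₃_mem {X Y Z : C.Obj} {l m n q : ℤ} (f : C.Hom Y X l) (g : C.Hom Z Y m)
    (h : C.Hom X Z n) (hq : l + ((m - 1) + (n - 1)) = q) : word₃ f g h ∈ chainsOfDegree C q :=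
  incl_mem_chainsOfDegree _ _ _ (by simpa [etaDeg, Fin.sum_univ_succ] using hq)

/-! ### The Hochschild differential on short words -/

/-- The target data `X'`, `p'`, `a'` are left free so that the `Function.update` in the degrees can
be matched with a literal tuple. -/
theorem incl_dAt_tprod {n : ℕ} {X : Fin (n + 1) → C.Obj} {p : Fin (n + 1) → ℤ} (i : Fin (n + 1))
    (a : ∀ j, Slot X p j) {X' : Fin (n + 1) → C.Obj} {p' : Fin (n + 1) → ℤ}
    {a' : ∀ j, Slot X' p' j} (hX : X = X') (hp : Function.update p i (p i + 1) = p')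
    (hi : HEq (C.d rfl (a i)) (a' i)) (hj : ∀ j, j ≠ i → HEq (a j) (a' j)) :
    incl _ _ (dAt X p i (PiTensorProduct.tprod k a)) =
      incl X' p' (PiTensorProduct.tprod k a') := by
  rw [dAt, PiTensorProduct.map_tprod]
  refine incl_tprod_congr hX hp fun j => ?_
  by_cases h : j = i
  · subst h
    rw [dif_pos rfl]
    exact (d_heq rfl rfl rfl HEq.rfl _ _).trans hi
  · rw [dif_neg h]
    exact (castHom_heq _ _ _ _).trans (hj j h)

theorem merge_tprod {n : ℕ} (X : Fin (n + 2) → C.Obj) (p : Fin (n + 2) → ℤ) (i : Fin (n + 1))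
    (a : ∀ j, Slot X p j) : merge X p i (PiTensorProduct.tprod k a) =
      PiTensorProduct.tprod k (fun j => mergeEntry X p i j a) :=
  PiTensorProduct.lift.tprod _

theorem rotate_tprod {n : ℕ} (X : Fin (n + 1) → C.Obj) (p : Fin (n + 1) → ℤ)
    (a : ∀ j, Slot X p j) : rotate X p (PiTensorProduct.tprod k a) =
      PiTensorProduct.tprod k (fun j => C.castHom
        (congrArg X (by rw [sub_add_cancel, add_sub_cancel_right])) rfl rfl (a (j - 1))) :=
  PiTensorProduct.lift.tprod _

theorem mergeEntry_lt_heq {n : ℕ} (X : Fin (n + 2) → C.Obj) (p : Fin (n + 2) → ℤ)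
    {i j : Fin (n + 1)} (h : j < i) (a : ∀ c, Slot X p c) :
    HEq (mergeEntry X p i j a) (a j.castSucc) := by
  rw [mergeEntry_lt _ _ h]
  exact castHom_heq _ _ _ _

theorem mergeEntry_gt_heq {n : ℕ} (X : Fin (n + 2) → C.Obj) (p : Fin (n + 2) → ℤ)
    {i j : Fin (n + 1)} (h : i < j) (a : ∀ c, Slot X p c) :
    HEq (mergeEntry X p i j a) (a j.succ) := by
  rw [mergeEntry_gt _ _ h]
  exact castHom_heq _ _ _ _

theorem mergeEntry_self_heq {n : ℕ} (X : Fin (n + 2) → C.Obj) (p : Fin (n + 2) → ℤ)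
    (i : Fin (n + 1)) (a : ∀ c, Slot X p c) {U V W : C.Obj} {m m' q : ℤ} {f : C.Hom V W m}
    {g : C.Hom U V m'} (hU : X (i.succ + 1) = U) (hV : X i.succ = V) (hW : X i.castSucc = W)
    (hm : p i.castSucc = m) (hm' : p i.succ = m') (hf : HEq (a i.castSucc) f)
    (hg : HEq (a i.succ) g) (h : m + m' = q) :
    HEq (mergeEntry X p i i a) (C.comp h f g) := by
  rw [mergeEntry_self]
  exact (castHom_heq _ _ _ _).trans
    (comp_heq hU hV hW hm hm' ((castHom_heq _ _ _ _).trans hf) hg _ _)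

theorem b_word₁ {X : C.Obj} {m m' : ℤ} (h : m + 1 = m') (f : C.Hom X X m) :
    b C (word₁ f) = word₁ (C.d h f) := by
  subst h
  rw [word₁, b_incl]
  simp only [b0, b1, LinearMap.comp_apply, Finset.univ_eq_empty, Finset.sum_empty,
    LinearMap.zero_apply, sub_zero, add_zero]
  refine incl_dAt_tprod _ _ rfl ?_ HEq.rfl ?_
  · funext j
    fin_cases j
    rfl
  · intro j hj
    fin_cases j
    exact absurd rfl hj

/-- All signs come from `η₀ = |f| = m`; the cyclic term carries the exponent `η₀(|g| + 1)`. -/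
theorem b_word₂ {X Y : C.Obj} {m n m' n' q : ℤ} (hm : m + 1 = m') (hn : n + 1 = n')
    (h : m + n = q) (h' : n + m = q) (f : C.Hom Y X m) (g : C.Hom X Y n) :
    b C (word₂ f g) = word₂ (C.d hm f) g - m.negOnePow • word₂ f (C.d hn g) +
      (m.negOnePow • word₁ (C.comp h f g) -
        (m * (n + 1)).negOnePow • word₁ (C.comp h' g f)) := by
  subst hm hn
  rw [word₂, b_incl]
  simp only [b0, b1, LinearMap.sub_apply, LinearMap.comp_apply, Fin.sum_univ_succ,
    Finset.univ_eq_empty, Finset.sum_empty, LinearMap.smul_apply, add_zero]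
  have e0 : etaDeg ![m, n] 0 = m := by simp [etaDeg, Fin.sum_univ_succ]
  simp only [Fin.val_zero, e0]
  congr 1
  · congr 1
    · refine incl_dAt_tprod _ _ rfl ?_ HEq.rfl ?_
      · funext j; fin_cases j <;> rfl
      · intro j hj; fin_cases j <;> first | exact absurd rfl hj | exact HEq.rfl
    · congr 1
      refine incl_dAt_tprod _ _ rfl ?_ HEq.rfl ?_
      · funext j; fin_cases j <;> rfl
      · intro j hj; fin_cases j <;> first | exact absurd rfl hj | exact HEq.rfl
  · congr 1
    · congr 1
      rw [merge_tprod]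
      refine incl_tprod_congr ?_ ?_ ?_
      · funext j; fin_cases j; rfl
      · funext j; fin_cases j; exact h
      · intro j; fin_cases j
        exact mergeEntry_self_heq _ _ _ _ rfl rfl rfl rfl rfl HEq.rfl HEq.rfl _
    · congr 1
      -- Rotation brings the last entry to slot 0, so the cyclic term is an ordinary merge at 0 of
      -- the rotated word.
      rw [rotate_tprod, merge_tprod]
      refine incl_tprod_congr ?_ ?_ ?_
      · funext j; fin_cases j; rfl
      · funext j; fin_cases j; exact h'
      · intro j; fin_cases j
        exact mergeEntry_self_heq _ _ _ _ rfl rfl rfl rfl rfl (castHom_heq _ _ _ _)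
          (castHom_heq _ _ _ _) _

/-- The parameter `s` is `η₁ = |f| + |g| - 1`. It governs the signs of `f[g|dh]` and `f[gh]`, and
enters the cyclic sign as `s(|h| + 1)`. -/
theorem b_word₃ {X Y Z : C.Obj} {l m n l' m' n' lm mn nl s : ℤ} (hl : l + 1 = l')
    (hm : m + 1 = m') (hn : n + 1 = n') (h₁ : l + m = lm) (h₂ : m + n = mn) (h₃ : n + l = nl)
    (hs : l + (m - 1) = s)
    (f : C.Hom Y X l) (g : C.Hom Z Y m) (h : C.Hom X Z n) :
    b C (word₃ f g h) =
      word₃ (C.d hl f) g h - (l.negOnePow • word₃ f (C.d hm g) h +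
        s.negOnePow • word₃ f g (C.d hn h)) +
      (l.negOnePow • word₂ (C.comp h₁ f g) h + s.negOnePow • word₂ f (C.comp h₂ g h) -
        (s * (n + 1)).negOnePow • word₂ (C.comp h₃ h f) g) := by
  subst hl hm hn h₁ h₂ h₃ hs
  rw [word₃, b_incl]
  simp only [b0, b1, LinearMap.sub_apply, LinearMap.add_apply, LinearMap.comp_apply,
    Fin.sum_univ_succ, Finset.univ_eq_empty, Finset.sum_empty, LinearMap.smul_apply, add_zero]
  have e0 : etaDeg ![l, m, n] 0 = l := by simp [etaDeg, Fin.sum_univ_succ]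
  have e1 : etaDeg ![l, m, n] 1 = l + (m - 1) := by simp [etaDeg, Fin.sum_univ_succ]
  simp only [Fin.val_zero, Fin.val_succ, zero_add, e0, e1]
  congr 1
  · congr 1
    · refine incl_dAt_tprod _ _ rfl ?_ HEq.rfl ?_
      · funext j; fin_cases j <;> rfl
      · intro j hj; fin_cases j <;> first | exact absurd rfl hj | exact HEq.rfl
    · congr 2
      · refine incl_dAt_tprod _ _ rfl ?_ HEq.rfl ?_
        · funext j; fin_cases j <;> rfl
        · intro j hj; fin_cases j <;> first | exact absurd rfl hj | exact HEq.rfl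
      · refine incl_dAt_tprod _ _ rfl ?_ HEq.rfl ?_
        · funext j; fin_cases j <;> rfl
        · intro j hj; fin_cases j <;> first | exact absurd rfl hj | exact HEq.rfl
  · congr 1
    · congr 2
      · rw [merge_tprod]
        refine incl_tprod_congr ?_ ?_ ?_
        · funext j; fin_cases j <;> rfl
        · funext j; fin_cases j <;> rfl
        · intro j; fin_cases j
          · exact mergeEntry_self_heq _ _ _ _ rfl rfl rfl rfl rfl HEq.rfl HEq.rfl _
          · exact mergeEntry_gt_heq _ _ (by decide) _
      · rw [merge_tprod]
        refine incl_tprod_congr ?_ ?_ ?_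
        · funext j; fin_cases j <;> rfl
        · funext j; fin_cases j <;> rfl
        · intro j; fin_cases j
          · exact mergeEntry_lt_heq _ _ (by decide) _
          · exact mergeEntry_self_heq _ _ _ _ rfl rfl rfl rfl rfl HEq.rfl HEq.rfl _
    · congr 1
      rw [rotate_tprod, merge_tprod]
      refine incl_tprod_congr ?_ ?_ ?_
      · funext j; fin_cases j <;> rfl
      · funext j; fin_cases j <;> rfl
      · intro j; fin_cases j
        · exact mergeEntry_self_heq _ _ _ _ rfl rfl rfl rfl rfl (castHom_heq _ _ _ _)
            (castHom_heq _ _ _ _) _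
        · exact (mergeEntry_gt_heq _ _ (by decide) _).trans (castHom_heq _ _ _ _)


/-! ### Multilinearity of short words -/

/-- Writing the single entry as a `Function.update` makes the multilinearity lemmas for `tprod`
applicable. -/
theorem word₁_eq_ofSubsingleton {X : C.Obj} {m : ℤ} (f : C.Hom X X m) :
    word₁ f = incl (n := 0) (fun _ => X) (fun _ => m)
      (PiTensorProduct.tprod k (Function.update (0 : ∀ i, Slot _ _ i) 0 f)) := by
  refine incl_tprod_congr rfl rfl fun i => ?_
  fin_cases i
  exact heq_of_eq (Function.update_self (β := fun i : Fin 1 =>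
    Slot (C := C) (n := 0) (fun _ => X) (fun _ => m) i) 0 f 0).symm

theorem word₁_sub {X : C.Obj} {m : ℤ} (f g : C.Hom X X m) :
    word₁ (f - g) = word₁ f - word₁ g := by
  rw [word₁_eq_ofSubsingleton, word₁_eq_ofSubsingleton f, word₁_eq_ofSubsingleton g, ← map_sub]
  congr 1
  exact MultilinearMap.map_update_sub _ _ _ _ _

theorem word₁_add {X : C.Obj} {m : ℤ} (f g : C.Hom X X m) :
    word₁ (f + g) = word₁ f + word₁ g := by
  rw [eq_comm, ← eq_sub_iff_add_eq, ← word₁_sub, add_sub_cancel_right]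

theorem update_entries₂_one {X Y : C.Obj} {m n : ℤ} (f : C.Hom Y X m) (g g' : C.Hom X Y n) :
    Function.update (entries₂ f g) 1 g' = entries₂ f g' := by
  funext i
  fin_cases i <;> rfl

theorem word₂_zero_left {X Y : C.Obj} {m n : ℤ} (g : C.Hom X Y n) :
    word₂ (0 : C.Hom Y X m) g = 0 := by
  rw [word₂, MultilinearMap.map_coord_zero _ 0 rfl, map_zero]

theorem word₂_zero_right {X Y : C.Obj} {m n : ℤ} (f : C.Hom Y X m) :
    word₂ f (0 : C.Hom X Y n) = 0 := by
  rw [word₂, MultilinearMap.map_coord_zero _ 1 rfl, map_zero]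

theorem word₂_neg_right {X Y : C.Obj} {m n : ℤ} (f : C.Hom Y X m) (g : C.Hom X Y n) :
    word₂ f (-g) = -word₂ f g := by
  have h := MultilinearMap.map_update_neg (PiTensorProduct.tprod k) (entries₂ f g) 1 g
  rw [update_entries₂_one] at h
  rw [word₂, word₂, ← map_neg, ← update_entries₂_one f g (-g)]
  exact congrArg _ h

theorem word₃_zero_left {X Y Z : C.Obj} {l m n : ℤ} (g : C.Hom Z Y m) (h : C.Hom X Z n) :
    word₃ (0 : C.Hom Y X l) g h = 0 := by
  rw [word₃, MultilinearMap.map_coord_zero _ 0 rfl, map_zero]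

theorem word₃_zero_middle {X Y Z : C.Obj} {l m n : ℤ} (f : C.Hom Y X l) (h : C.Hom X Z n) :
    word₃ f (0 : C.Hom Z Y m) h = 0 := by
  rw [word₃, MultilinearMap.map_coord_zero _ 1 rfl, map_zero]

theorem word₃_zero_right {X Y Z : C.Obj} {l m n : ℤ} (f : C.Hom Y X l) (g : C.Hom Z Y m) :
    word₃ f g (0 : C.Hom X Z n) = 0 := by
  rw [word₃, MultilinearMap.map_coord_zero _ 2 rfl, map_zero]

/-! ### Classes of endomorphisms in degree zero Hochschild homology -/

/-- The class in `HH₀(C)` of a closed endomorphism of degree `0`. -/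
def endClass {X : C.Obj} (f : C.Hom X X 0) (hf : C.d (zero_add 1) f = 0) : HH C 0 :=
  Submodule.Quotient.mk ⟨endChain C X f, endChain_mem C X f hf⟩

theorem mk_eq_zero_of_eq_b {x : cycles C 0} {z : Chains C}
    (hz : z ∈ chainsOfDegree C (-1)) (h : x.1 = b C z) :
    (Submodule.Quotient.mk x : HH C 0) = 0 := by
  rw [Submodule.Quotient.mk_eq_zero]
  exact ⟨z, by simpa using hz, h.symm⟩

/-- Homotopic endomorphisms have the same class. -/
theorem endClass_eq_of_homotopy {X : C.Obj} {f g : C.Hom X X 0} (hf : C.d (zero_add 1) f = 0)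
    (hg : C.d (zero_add 1) g = 0) (h : C.Hom X X (-1))
    (e : f - g = C.d (neg_add_cancel 1) h) : endClass f hf = endClass g hg := by
  rw [← sub_eq_zero]
  -- The bounding chain is the homotopy itself: `b₁` vanishes on words of length one.
  refine mk_eq_zero_of_eq_b (x := ⟨endChain C X f, _⟩ - ⟨endChain C X g, _⟩)
    (word₁_mem h rfl) ?_
  rw [b_word₁ (neg_add_cancel 1), ← e, word₁_sub]
  rfl

/-- The trace property `[fg] = [gf]`. -/
theorem endClass_comp_comm {X Y : C.Obj} {f : C.Hom Y X 0} {g : C.Hom X Y 0}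
    (hf : C.d (zero_add 1) f = 0) (hg : C.d (zero_add 1) g = 0)
    (hfg : C.d (zero_add 1) (C.comp (add_zero 0) f g) = 0)
    (hgf : C.d (zero_add 1) (C.comp (add_zero 0) g f) = 0) :
    endClass _ hfg = endClass _ hgf := by
  rw [← sub_eq_zero]
  -- The word `f[g]` has degree `0 + (0 - 1)`, and its boundary is `fg - gf` since both entries are
  -- closed.
  refine mk_eq_zero_of_eq_b (x := ⟨endChain C X _, _⟩ - ⟨endChain C Y _, _⟩)
    (word₂_mem f g rfl) ?_
  rw [b_word₂ (zero_add 1) (zero_add 1) (add_zero 0) (add_zero 0), hf, hg, word₂_zero_left,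
    word₂_zero_right]
  simp only [zero_mul, Int.negOnePow_zero, one_smul, smul_zero, sub_zero, zero_add]
  rfl

/-- An isomorphism in `Ho(C)` is given by a pair of mutually inverse homotopy equivalences. -/
theorem exists_homotopyRel_of_iso {X Y : C.Obj} (e : C.toHo X ≅ C.toHo Y) :
    ∃ (f : (⟨X⟩ : Z0 C) ⟶ ⟨Y⟩) (g : (⟨Y⟩ : Z0 C) ⟶ ⟨X⟩),
      C.homotopyRel (f ≫ g) (𝟙 _) ∧ C.homotopyRel (g ≫ f) (𝟙 _) := by
  obtain ⟨f, hf⟩ : ∃ f : (⟨X⟩ : Z0 C) ⟶ ⟨Y⟩, C.homClass.map f = e.hom :=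
    C.homClass.map_surjective
      (show C.homClass.obj ⟨X⟩ ⟶ C.homClass.obj ⟨Y⟩ from e.hom)
  obtain ⟨g, hg⟩ : ∃ g : (⟨Y⟩ : Z0 C) ⟶ ⟨X⟩, C.homClass.map g = e.inv :=
    C.homClass.map_surjective
      (show C.homClass.obj ⟨Y⟩ ⟶ C.homClass.obj ⟨X⟩ from e.inv)
  -- Homotopy is a congruence, so equal classes in the quotient come from an actual homotopy.
  refine ⟨f, g, (CategoryTheory.Quotient.functor_map_eq_iff _ _ _).1 ?_,
    (CategoryTheory.Quotient.functor_map_eq_iff _ _ _).1 ?_⟩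
  · change C.homClass.map (f ≫ g) = _
    rw [Functor.map_comp, hf, hg]
    exact e.hom_inv_id.trans (C.homClass.map_id _).symm
  · change C.homClass.map (g ≫ f) = _
    rw [Functor.map_comp, hf, hg]
    exact e.inv_hom_id.trans (C.homClass.map_id _).symm

/-- The class of the identity is invariant under homotopy equivalence. -/
theorem endClass_one_eq_of_homotopyRel {X Y : C.Obj} (f : (⟨X⟩ : Z0 C) ⟶ ⟨Y⟩)
    (g : (⟨Y⟩ : Z0 C) ⟶ ⟨X⟩) (h₁ : C.homotopyRel (f ≫ g) (𝟙 _))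
    (h₂ : C.homotopyRel (g ≫ f) (𝟙 _)) :
    endClass (C.one X) (C.d_one X _) = endClass (C.one Y) (C.d_one Y _) := by
  obtain ⟨s, hs⟩ := h₁
  obtain ⟨t, ht⟩ := h₂
  -- The chain of equalities is `[1_X] = [gf] = [fg] = [1_Y]`, with the trace property in the
  -- middle.
  exact (endClass_eq_of_homotopy (f ≫ g).closed (C.d_one X _) s hs).symm.trans
    ((endClass_comp_comm g.closed f.closed (f ≫ g).closed (g ≫ f).closed).trans
      (endClass_eq_of_homotopy (g ≫ f).closed (C.d_one Y _) t ht))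

/-- Objects related by a closed isomorphism of degree `1` have opposite classes. -/
theorem endClass_one_eq_neg {X Y : C.Obj} (s : C.Hom Y X 1) (t : C.Hom X Y (-1))
    (hs : C.d (one_add_one_eq_two) s = 0) (ht : C.d (neg_add_cancel 1) t = 0)
    (hst : C.comp (add_neg_cancel 1) s t = C.one X)
    (hts : C.comp (neg_add_cancel 1) t s = C.one Y) :
    endClass (C.one Y) (C.d_one Y _) = -endClass (C.one X) (C.d_one X _) := by
  rw [eq_neg_iff_add_eq_zero]
  -- In the boundary of `s[t]` the term `st` has sign `(-1)^1`, and `ts` has sign `-(-1)^(1·(-1+1))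
  -- = -1`. The two identities thus occur with the same sign, and the bounding chain is `-s[t]`.
  refine mk_eq_zero_of_eq_b (x := ⟨endChain C Y _, _⟩ + ⟨endChain C X _, _⟩)
    (neg_mem (word₂_mem s t rfl)) ?_
  rw [map_neg, b_word₂ one_add_one_eq_two (neg_add_cancel 1) (add_neg_cancel 1)
    (neg_add_cancel 1), hs, ht, word₂_zero_left, word₂_zero_right, hst, hts]
  simp only [neg_add_cancel, mul_zero, Int.negOnePow_zero, Int.negOnePow_one, one_smul,
    smul_zero, sub_zero, zero_add, Units.neg_smul]
  change word₁ _ + word₁ _ = _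
  abel

/-- Additivity of the class of the identity for an extension `M → E → K` of objects of `C` that
splits as an extension of graded objects, with connecting morphism `c : K → M` of degree `1`. -/
theorem endClass_one_eq_add {K M E : C.Obj} (i : C.Hom K E 0) (r : C.Hom E K 0) (j : C.Hom M E 0)
    (t : C.Hom E M 0) (c : C.Hom K M 1) (hr : C.d (zero_add 1) r = 0)
    (hj : C.d (zero_add 1) j = 0) (hc : C.d one_add_one_eq_two c = 0)
    (hi : C.d (zero_add 1) i = C.comp (zero_add 1) j c)
    (ht : C.d (zero_add 1) t = -C.comp (add_zero 1) c r)
    (hri : C.comp (add_zero 0) r i = C.one K) (htj : C.comp (add_zero 0) t j = C.one M)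
    (hrj : C.comp (add_zero 0) r j = 0)
    (hE : C.comp (add_zero 0) i r + C.comp (add_zero 0) j t = C.one E) :
    endClass (C.one E) (C.d_one E _) =
      endClass (C.one K) (C.d_one K _) + endClass (C.one M) (C.d_one M _) := by
  rw [← sub_eq_zero]
  -- The bounding chain is `i[r] + j[t] - j[c|r]`. Its three boundaries are `(jc)[r] + ir - 1_K`,
  -- `j[cr] + jt - 1_M` and `(jc)[r] + j[cr] - (rj)[c]`, where the last term is zero.
  refine mk_eq_zero_of_eq_b
    (x := ⟨endChain C E _, _⟩ - (⟨endChain C K _, _⟩ + ⟨endChain C M _, _⟩))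
    (sub_mem (add_mem (word₂_mem i r rfl) (word₂_mem j t rfl)) (word₃_mem j c r rfl)) ?_
  rw [map_sub, map_add, b_word₂ (zero_add 1) (zero_add 1) (add_zero 0) (add_zero 0),
    b_word₂ (zero_add 1) (zero_add 1) (add_zero 0) (add_zero 0),
    b_word₃ (s := 0) (zero_add 1) one_add_one_eq_two (zero_add 1) (zero_add 1) (add_zero 1)
      (add_zero 0) rfl, hr, hj, hc, hi, ht, hri, htj, hrj]
  simp only [word₂_zero_left, word₂_zero_right, word₃_zero_left, word₃_zero_middle,
    word₃_zero_right, word₂_neg_right, zero_mul, Int.negOnePow_zero, one_smul, smul_zero,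
    sub_zero, zero_add, smul_neg]
  change word₁ _ - (word₁ _ + word₁ _) = _
  rw [← hE, word₁_add]
  abel

end DG.DGCategory

/-! ### The Euler class of shifts, cones and distinguished triangles -/

namespace DG

open DGCategory

variable {k : Type u} [Field k] {A : DGAlgebra.{u, v} k}

/-- The same idempotent splits through `N`. This is needed because the cone modelling a
distinguished triangle is built from modules not given as perfect. -/
theorem DGModule.IsPerfect.of_iso {M N : DGModule A} (h : M.IsPerfect)
    (e : (Mod A).toHo M ≅ (Mod A).toHo N) : N.IsPerfect := by
  obtain ⟨S, hS, π, f, g, h₁, h₂, h₃⟩ := h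
  exact ⟨S, hS, π, f ≫ e.hom, e.inv ≫ g, h₁, by simp [reassoc_of% h₂], by simp [h₃]⟩

/-- The Euler class is invariant under isomorphism in `Ho(Mod A)`. -/
theorem Eu_eq_of_iso {M N : (Perf A).Obj} (e : (Mod A).toHo M.1 ≅ (Mod A).toHo N.1) :
    Eu M = Eu N := by
  obtain ⟨f, g, h₁, h₂⟩ := exists_homotopyRel_of_iso e
  -- `Perf A` is full in `Mod A`, so the maps and homotopies found there serve verbatim.
  exact endClass_one_eq_of_homotopyRel (C := Perf A) (X := M) (Y := N) ⟨f.val, f.closed⟩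
    ⟨g.val, g.closed⟩ h₁ h₂

/-- Both `s` and `t` are the identity of the underlying space. They are closed because the sign
`(-1)^n`, for `n = ±1`, in the differential of `Hom` compensates the sign of the differential of
`N[1]`. -/
theorem Eu_shiftPerf (N : (Perf A).Obj) : Eu (shiftPerf N) = -Eu N := by
  let s : (Perf A).Hom (shiftPerf N) N 1 := ⟨LinearMap.id, fun _ _ => rfl, fun _ _ h => h⟩
  let t : (Perf A).Hom N (shiftPerf N) (-1) := ⟨LinearMap.id, fun _ _ => rfl, fun i m hm => by
    change m ∈ N.1.gr (i + -1 + 1)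
    rwa [neg_add_cancel_right]⟩
  refine endClass_one_eq_neg (C := Perf A) s t ?_ ?_ rfl rfl
  · refine Subtype.ext (LinearMap.ext fun x => ?_)
    refine (DGModule.homD_apply N.1.shift N.1 one_add_one_eq_two s x).trans ?_
    change N.1.d x - (1 : ℤ).negOnePow • -N.1.d x = 0
    simp
  · refine Subtype.ext (LinearMap.ext fun x => ?_)
    refine (DGModule.homD_apply N.1 N.1.shift (neg_add_cancel 1) t x).trans ?_
    change -N.1.d x - (-1 : ℤ).negOnePow • N.1.d x = 0
    simp

/-- The cone splits as a graded module, and `p` survives only as the off-diagonal part of its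
differential, that is, as the degree 1 morphism `c : L[1] → M`. -/
theorem Eu_cone {L M : (Perf A).Obj} (p : (⟨L.1⟩ : Z0 (Mod A)) ⟶ ⟨M.1⟩)
    (h : (DGModule.cone p.val p.closed).IsPerfect) :
    Eu ⟨DGModule.cone p.val p.closed, h⟩ = Eu (shiftPerf L) + Eu M := by
  let E : (Perf A).Obj := ⟨DGModule.cone p.val p.closed, h⟩
  let i : (Perf A).Hom (shiftPerf L) E 0 := ⟨LinearMap.inl k L.1.carrier M.1.carrier,
    fun a m => Prod.ext rfl (smul_zero _).symm,
    fun i m hm => ⟨by rw [add_zero]; exact hm, zero_mem _⟩⟩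
  let t : (Perf A).Hom E M 0 := ⟨LinearMap.snd k L.1.carrier M.1.carrier,
    fun a m => rfl, fun i m hm => by rw [add_zero]; exact hm.2⟩
  let c : (Perf A).Hom (shiftPerf L) M 1 := ⟨p.val.1, p.val.2.1, fun i m hm => by
    have := p.val.2.2 (i + 1) m hm
    rwa [add_zero] at this⟩
  refine endClass_one_eq_add (C := Perf A) i (coneFst p).val (coneInr p).val t c
    (coneFst p).closed (coneInr p).closed ?_ ?_ ?_ rfl rfl rfl ?_
  · refine Subtype.ext (LinearMap.ext fun x => ?_)
    refine (DGModule.homD_apply L.1.shift M.1 one_add_one_eq_two c x).trans ?_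
    change M.1.d (p.val.1 x) - (1 : ℤ).negOnePow • p.val.1 (-L.1.d x) = 0
    rw [map_neg, closed_apply p.val p.closed x]
    simp
  · refine Subtype.ext (LinearMap.ext fun x => ?_)
    refine (DGModule.homD_apply L.1.shift E.1 (zero_add 1) i x).trans ?_
    rw [Int.negOnePow_zero, one_smul]
    -- The inclusion of `L[1]` fails to be closed exactly by the `p`-component of the cone
    -- differential, which is `jc`.
    refine Prod.ext (sub_self (-L.1.d x)) ?_
    change p.val.1 x + M.1.d 0 - 0 = p.val.1 x
    rw [map_zero, add_zero, sub_zero]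
  · refine Subtype.ext (LinearMap.ext fun x => ?_)
    refine (DGModule.homD_apply E.1 M.1 (zero_add 1) t x).trans ?_
    change M.1.d x.2 - (0 : ℤ).negOnePow • (p.val.1 x.1 + M.1.d x.2) = -p.val.1 x.1
    simp
  · refine Subtype.ext (LinearMap.ext fun x => ?_)
    exact Prod.ext (add_zero x.1) (zero_add x.2)

/-- By homotopy invariance the triangle may be replaced by a standard cone triangle, where `Eu (Cone
f) = Eu (L'[1]) + Eu M' = -Eu L' + Eu M'`. -/
theorem Eu_eq_add_of_isPerfDistinguished {L M N : (Perf A).Obj}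
    {p : (Perf A).toHo L ⟶ (Perf A).toHo M} {q : (Perf A).toHo M ⟶ (Perf A).toHo N}
    {r : (Perf A).toHo N ⟶ (Perf A).toHo (shiftPerf L)} (h : IsPerfDistinguished p q r) :
    Eu M = Eu L + Eu N := by
  obtain ⟨L', M', f, e₁, e₂, e₃, -⟩ := h
  have hN := Eu_eq_of_iso (M := N) (N := ⟨_, N.2.of_iso e₃⟩) e₃
  rw [Eu_eq_of_iso (M := L) (N := ⟨_, L.2.of_iso e₁⟩) e₁,
    Eu_eq_of_iso (M := M) (N := ⟨_, M.2.of_iso e₂⟩) e₂, hN,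
    Eu_cone (L := ⟨_, L.2.of_iso e₁⟩) (M := ⟨_, M.2.of_iso e₂⟩) f, Eu_shiftPerf,
    add_neg_cancel_left]

end DG

end

/-! ### Factorisation through the Grothendieck group -/

theorem proposition3p2 {k : Type u} [Field k] (A : DG.DGAlgebra.{u, v} k) :
    (∀ N : (DG.Perf A).Obj, DG.Eu (DG.shiftPerf N) = -DG.Eu N) ∧
    (∀ (L M N : (DG.Perf A).Obj) (p : (DG.Perf A).toHo L ⟶ (DG.Perf A).toHo M)
      (q : (DG.Perf A).toHo M ⟶ (DG.Perf A).toHo N)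
      (r : (DG.Perf A).toHo N ⟶ (DG.Perf A).toHo (DG.shiftPerf L)),
      DG.IsPerfDistinguished p q r → DG.Eu M = DG.Eu L + DG.Eu N) ∧
    (∃! φ : DG.K0 A →+ DG.DGCategory.HH (DG.Perf A) 0,
      ∀ N : (DG.Perf A).Obj, φ (DG.K0.mk N) = DG.Eu N) := by
  refine ⟨DG.Eu_shiftPerf, fun L M N p q r h => DG.Eu_eq_add_of_isPerfDistinguished h,
    QuotientAddGroup.lift (DG.K0Relations A) (FreeAbelianGroup.lift DG.Eu) ?_, fun N => ?_,
    fun ψ hψ => ?_⟩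
  -- The kernel is a subgroup, so only the generating relations need to be checked, and these vanish
  -- by additivity.
  · refine (AddSubgroup.closure_le _).2 ?_
    rintro x ⟨L, M, N, p, q, r, h, rfl⟩
    change FreeAbelianGroup.lift DG.Eu _ = 0
    rw [map_sub, map_add, FreeAbelianGroup.lift_apply_of, FreeAbelianGroup.lift_apply_of,
      FreeAbelianGroup.lift_apply_of, DG.Eu_eq_add_of_isPerfDistinguished h, sub_self]
  · exact FreeAbelianGroup.lift_apply_of _ _
  -- Uniqueness holds because the symbols `[N]` generate `K0 A`.
  · refine QuotientAddGroup.addMonoidHom_ext _ (FreeAbelianGroup.lift_ext _ _ fun N => ?_)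
    exact (hψ N).trans (FreeAbelianGroup.lift_apply_of _ _).symm
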